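/- Let $\mathsf{TOF}$ be the strict symmetric monoidal category with objects the natural numbers generated by the ancillary bits $|1\rangle:0\to1$ and $\langle1|:1\to0$ and the Toffoli gate $\mathsf{tof}:3\to3$, subject to the following identities. Composition is written in diagrammatic order with $;$, wires are numbered from the top, and $\sigma$ is the crossing of two wires. Abbreviate $\mathsf{cnot}:=(|1\rangle\otimes1_2);\mathsf{tof};(\langle1|\otimes1_2)$, $\mathsf{not}:=(|1\rangle\otimes1_1);\mathsf{cnot};(\langle1|\otimes1_1)$, $|0\rangle:=|1\rangle;\mathsf{not}$, $\langle0|:=\mathsf{not};\langle1|$; write $[X\to z]$ for the gate $\mathsf{tof}$ ($|X|=2$) or $\mathsf{cnot}$ ($|X|=1$) with control wires $X$ (in increasing order, except that for a target above its controls the order of wires is reversed) and target wire $z$, obtained by conjugating with wire crossings. The seventeen identities are: 1. $(|1\rangle\otimes1_2);\mathsf{tof}=|1\rangle\otimes\mathsf{cnot}$ and $\mathsf{tof};(\langle1|\otimes1_2)=\langle1|\otimes\mathsf{cnot}$; 2. $(|0\rangle\otimes1_2);\mathsf{tof}=|0\rangle\otimes1_2$ and $\mathsf{tof};(\langle0|\otimes1_2)=\langle0|\otimes1_2$;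 3. $[12\to3]$ and $[45\to3]$ commute (5 wires); 4. $[23\to1]$ and $[34\to5]$ commute (5 wires); 5. $[23\to1]$ and $[23\to4]$ commute (4 wires); 6. $[13\to4]$ and $[23\to4]$ commute (4 wires); 7. $(1_2\otimes|1\rangle);[1\to3];(1_2\otimes\langle0|);(1_2\otimes|1\rangle);[2\to3];(1_2\otimes\langle0|)=(1_2\otimes|1\rangle);\mathsf{tof};(1_2\otimes\langle0|)$; 8. $(|1\rangle;\langle0|)\otimes1_1=(|1\rangle;\langle0|)\otimes(\langle1|;|1\rangle)$; 9. $|1\rangle;\langle1|=1_0$; 10. $\mathsf{tof};\mathsf{tof}=1_3$; 11. $[23\to4];[12\to3];[23\to4]=[12\to4];[12\to3]$; 12. $[1\to2];[23\to4];[1\to2]=[13\to4];[23\to4]$; 13. $[12\to3];[23\to4];[12\to3]=[12\to4];[23\to4]$; 14. $[12\to3];[3\to4];[12\to3]=[12\to4];[3\to4]$; 15. $[1\to2];[2\to1];[1\to2]=\sigma$; 16. $\mathsf{tof}=(\sigma\otimes1_1);\mathsf{tof};(\sigma\otimes1_1)$; 17. $t=(1_1\otimes\sigma\otimes1_1);t;(1_1\otimes\sigma\otimes1_1)$,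 where $t:=(1_2\otimes|0\rangle\otimes1_2);[12\to3];[34\to5];[12\to3];(1_2\otimes\langle0|\otimes1_2):4\to4$. Let $f^\circ$ be the map obtained by flipping a circuit horizontally (exchanging $|1\rangle$ and $\langle1|$), and call $f:n\to m$ total if $f;f^\circ=1_n$. The total maps $0\to n$ (total points of $n$) are exactly the $2^n$ distinct maps $|b_1,\dots,b_n\rangle=|b_1\rangle\otimes\cdots\otimes|b_n\rangle$ with $b\in\mathbb Z_2^n$. Let $\mathsf{FPinj}_2$ be the category with objects the sets $\mathbb Z_2^n$, $n\in\mathbb N$, and with all partial isomorphisms (partially defined injective functions) as maps, and let $\tilde H_0:\mathsf{TOF}\to\mathsf{FPinj}_2$ be the functor $n\mapsto\mathbb Z_2^n$ which evaluates maps on total points: for $f:n\to m$, $\tilde H_0(f)$ sends $b$ to $c$ if $|b\rangle;f=|c\rangle$, and is undefined at $b$ if $|b\rangle;f$ is not total. **Proposition.** The functor $\tilde H_0:\mathsf{TOF}\to\mathsf{FPinj}_2$ is full: for all $n,m$, every partial isomorphism $\mathbb Z_2^n\to\mathbb Z_2^m$ is $\tilde H_0(f)$ for some $f:n\to m$ in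 $\mathsf{TOF}$. Moreover, total functions are simulated, with extra outputs, by polynomial-form circuits. Let $\mathsf{cnot}_0:=\mathsf{not}$, $\mathsf{cnot}_1:=\mathsf{cnot}$, $\mathsf{cnot}_2:=\mathsf{tof}$ and, for $k\ge2$, $\mathsf{cnot}_{k+1}:=(1_2\otimes|0\rangle\otimes1_k);(\mathsf{tof}\otimes1_k);(1_2\otimes\mathsf{cnot}_k);(\mathsf{tof}\otimes1_k);(1_2\otimes\langle0|\otimes1_k)$; in $\mathsf{cnot}_k:k+1\to k+1$ the first $k$ wires are controls and the last is the target. A circuit $n+1\to n+1$ is in polynomial form if it is a composite of $\mathsf{cnot}_j$ gates ($j\ge0$), each with control wires among the first $n$ wires and target the last wire. Then for all $n,m$ and every function $f:\mathbb Z_2^n\to\mathbb Z_2^m$ there are circuits $q_1,\dots,q_m:n+1\to n+1$ in polynomial form such that $P_m:n\to n+m$, defined by $P_0=1_n$ and $P_{i+1}=(1_n\otimes|0\rangle);q_{i+1};(P_i\otimes1_1)$, satisfies $\tilde H_0(P_m)=\langle1,f\rangle$, that is, $\tilde H_0(P_m)(b)=(b,f(b))$ for all $b\in\mathbb Z_2^n$.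 -/

import Mathlib

namespace Toffoli

/-! ### Circuits over the Toffoli gate and the ancillary bits -/

/-- Terms of the free strict symmetric monoidal category (with objects the natural numbers) on the
generators `ketOne` (the input ancilla `|1⟩`), `braOne` (the output ancilla `⟨1|`) and the
Toffoli gate `tof`. Wires are listed from top to bottom, composition is diagrammatic. -/
inductive Circ : ℕ → ℕ → Type
  | id (n : ℕ) : Circ n n
  | comp {n m k : ℕ} (f : Circ n m) (g : Circ m k) : Circ n k
  | tensor {n m n' m' : ℕ} (f : Circ n m) (g : Circ n' m') : Circ (n + n') (m + m')
  | symm (n m : ℕ) : Circ (n + m) (m + n)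
  | ketOne : Circ 0 1
  | braOne : Circ 1 0
  | tof : Circ 3 3

notation:70 f:70 " ⨾ " g:71 => Circ.comp (f :) (g :)
notation:80 f:80 " ⊠ " g:81 => Circ.tensor (f :) (g :)

namespace Circ

/-- Transport of a circuit along equalities of the numbers of wires. -/
def cast {n m n' m' : ℕ} (hn : n = n') (hm : m = m') (f : Circ n m) : Circ n' m' :=
  hn ▸ hm ▸ f

/-- The horizontal flip of a circuit. -/
def dag : {n m : ℕ} → Circ n m → Circ m n
  | _, _, id n => id n
  | _, _, comp f g => comp (dag g) (dag f)
  | _, _, tensor f g => tensor (dag f) (dag g)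
  | _, _, symm n m => symm m n
  | _, _, ketOne => braOne
  | _, _, braOne => ketOne
  | _, _, tof => tof

/-- The crossing of two wires. -/
def swap : Circ 2 2 := symm 1 1

/-- The `cnot` gate (control on the first wire, target the second). -/
def cnot : Circ 2 2 := (ketOne ⊠ id 2) ⨾ tof ⨾ (braOne ⊠ id 2)

/-- The `not` gate. -/
def not : Circ 1 1 := (ketOne ⊠ id 1) ⨾ cnot ⨾ (braOne ⊠ id 1)

/-- The input ancilla `|0⟩`. -/
def ketZero : Circ 0 1 := ketOne ⨾ not

/-- The output ancilla `⟨0|`. -/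
def braZero : Circ 1 0 := not ⨾ braOne

/-- The permutation of three wires exchanging the first and the third. -/
def rev3 : Circ 3 3 := (swap ⊠ id 1) ⨾ (id 1 ⊠ swap) ⨾ (swap ⊠ id 1)

/-- The flipped Toffoli gate: target on the first wire, controls on the second and third. -/
def tofFlip : Circ 3 3 := rev3 ⨾ tof ⨾ rev3

/-- The flipped `cnot` gate: target on the first wire, control on the second. -/
def cnotFlip : Circ 2 2 := swap ⨾ cnot ⨾ swap

/-- The `cnot` gate with control on wire 1 and target wire 3, among three wires. -/
def cnot13 : Circ 3 3 := (id 1 ⊠ swap) ⨾ (cnot ⊠ id 1) ⨾ (id 1 ⊠ swap)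

/-- The Toffoli gate with controls on wires 1, 3 and target wire 4, among four wires. -/
def tof134 : Circ 4 4 := (swap ⊠ id 2) ⨾ (id 1 ⊠ tof) ⨾ (swap ⊠ id 2)

/-- The Toffoli gate with controls on wires 1, 2 and target wire 4, among four wires. -/
def tof124 : Circ 4 4 := (id 2 ⊠ swap) ⨾ (tof ⊠ id 1) ⨾ (id 2 ⊠ swap)

/-- The middle circuit of the last identity: a `not` gate controlled by three wires, made of three
Toffoli gates and a zero ancilla on the third of five wires. -/
def tripleControl : Circ 4 4 :=
  (id 2 ⊠ ketZero ⊠ id 2) ⨾ (tof ⊠ id 2) ⨾ (id 2 ⊠ tof) ⨾ (tof ⊠ id 2) ⨾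
    (id 2 ⊠ braZero ⊠ id 2)

/-- The congruence defining `TOF`: the laws of a strict symmetric monoidal category together
with the seventeen identities for the Toffoli gate and the ancillary bits. -/
inductive Rel : {n m : ℕ} → Circ n m → Circ n m → Prop
  -- equivalence relation and congruence
  | refl {n m : ℕ} (f : Circ n m) : Rel f f
  | symm {n m : ℕ} {f g : Circ n m} : Rel f g → Rel g f
  | trans {n m : ℕ} {f g h : Circ n m} : Rel f g → Rel g h → Rel f h
  | comp {n m k : ℕ} {f f' : Circ n m} {g g' : Circ m k} :
      Rel f f' → Rel g g' → Rel (f ⨾ g) (f' ⨾ g')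
  | tensor {n m n' m' : ℕ} {f f' : Circ n m} {g g' : Circ n' m'} :
      Rel f f' → Rel g g' → Rel (f ⊠ g) (f' ⊠ g')
  -- category laws
  | id_comp {n m : ℕ} (f : Circ n m) : Rel (id n ⨾ f) f
  | comp_id {n m : ℕ} (f : Circ n m) : Rel (f ⨾ id m) f
  | assoc {n m k l : ℕ} (f : Circ n m) (g : Circ m k) (h : Circ k l) :
      Rel (f ⨾ g ⨾ h) (f ⨾ (g ⨾ h))
  -- strict monoidal laws
  | tensor_id (n m : ℕ) : Rel (id n ⊠ id m) (id (n + m))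
  | interchange {n m k n' m' k' : ℕ} (f : Circ n m) (g : Circ m k)
      (f' : Circ n' m') (g' : Circ m' k') :
      Rel ((f ⨾ g) ⊠ (f' ⨾ g')) ((f ⊠ f') ⨾ (g ⊠ g'))
  | tensor_assoc {n m n' m' n'' m'' : ℕ} (f : Circ n m) (g : Circ n' m') (h : Circ n'' m'') :
      Rel (cast (Nat.add_assoc n n' n'') (Nat.add_assoc m m' m'') (f ⊠ g ⊠ h)) (f ⊠ (g ⊠ h))
  | tensor_unit {n m : ℕ} (f : Circ n m) : Rel (f ⊠ id 0) f
  | unit_tensor {n m : ℕ} (f : Circ n m) :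
      Rel (cast (Nat.zero_add n) (Nat.zero_add m) (id 0 ⊠ f)) f
  -- symmetry laws
  | symm_natural {n m n' m' : ℕ} (f : Circ n m) (g : Circ n' m') :
      Rel ((f ⊠ g) ⨾ Circ.symm m m') (Circ.symm n n' ⨾ (g ⊠ f))
  | symm_symm (n m : ℕ) : Rel (Circ.symm n m ⨾ Circ.symm m n) (id (n + m))
  | symm_unit (n : ℕ) : Rel (Circ.symm n 0) (cast rfl (Nat.zero_add n).symm (id n))
  | hexagon (n m k : ℕ) :
      Rel (Circ.symm n (m + k))
        (cast (Nat.add_assoc n m k) (Nat.add_assoc m n k) (Circ.symm n m ⊠ id k) ⨾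
          cast rfl (Nat.add_assoc m k n).symm (id m ⊠ Circ.symm n k))
  -- the seventeen identities
  | tof1 : Rel ((ketOne ⊠ id 2) ⨾ tof) (ketOne ⊠ cnot)
  | tof1_flip : Rel (tof ⨾ (braOne ⊠ id 2)) (braOne ⊠ cnot)
  | tof2 : Rel ((ketZero ⊠ id 2) ⨾ tof) (ketZero ⊠ id 2)
  | tof2_flip : Rel (tof ⨾ (braZero ⊠ id 2)) (braZero ⊠ id 2)
  | tof3 : Rel ((tof ⊠ id 2) ⨾ (id 2 ⊠ tofFlip)) ((id 2 ⊠ tofFlip) ⨾ (tof ⊠ id 2))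
  | tof4 : Rel ((tofFlip ⊠ id 2) ⨾ (id 2 ⊠ tof)) ((id 2 ⊠ tof) ⨾ (tofFlip ⊠ id 2))
  | tof5 : Rel ((tofFlip ⊠ id 1) ⨾ (id 1 ⊠ tof)) ((id 1 ⊠ tof) ⨾ (tofFlip ⊠ id 1))
  | tof5_5 : Rel (tof134 ⨾ (id 1 ⊠ tof)) ((id 1 ⊠ tof) ⨾ tof134)
  | tof6 : Rel
      ((id 2 ⊠ ketOne) ⨾ cnot13 ⨾ (id 2 ⊠ braZero) ⨾
        (id 2 ⊠ ketOne) ⨾ (id 1 ⊠ cnot) ⨾ (id 2 ⊠ braZero))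
      ((id 2 ⊠ ketOne) ⨾ tof ⨾ (id 2 ⊠ braZero))
  | tof7 : Rel ((ketOne ⨾ braZero) ⊠ id 1) ((ketOne ⨾ braZero) ⊠ (braOne ⨾ ketOne))
  | tof8 : Rel (ketOne ⨾ braOne) (id 0)
  | tof9 : Rel (tof ⨾ tof) (id 3)
  | tof10 : Rel ((id 1 ⊠ tof) ⨾ (tof ⊠ id 1) ⨾ (id 1 ⊠ tof)) (tof124 ⨾ (tof ⊠ id 1))
  | tof11 : Rel ((cnot ⊠ id 2) ⨾ (id 1 ⊠ tof) ⨾ (cnot ⊠ id 2)) (tof134 ⨾ (id 1 ⊠ tof))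
  | tof12 : Rel ((tof ⊠ id 1) ⨾ (id 1 ⊠ tof) ⨾ (tof ⊠ id 1)) (tof124 ⨾ (id 1 ⊠ tof))
  | tof13 : Rel ((tof ⊠ id 1) ⨾ (id 2 ⊠ cnot) ⨾ (tof ⊠ id 1)) (tof124 ⨾ (id 2 ⊠ cnot))
  | tof14 : Rel (cnot ⨾ cnotFlip ⨾ cnot) swap
  | tof15 : Rel tof ((swap ⊠ id 1) ⨾ tof ⨾ (swap ⊠ id 1))
  | tof16 : Rel tripleControl
      ((id 1 ⊠ swap ⊠ id 1) ⨾ tripleControl ⨾ (id 1 ⊠ swap ⊠ id 1))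

/-- Circuits modulo the defining congruence. -/
instance setoid (n m : ℕ) : Setoid (Circ n m) where
  r := Rel
  iseqv := ⟨Rel.refl, Rel.symm, Rel.trans⟩

end Circ

/-! ### The category `TOF` -/

/-- The objects of `TOF`: natural numbers (of wires). -/
structure TOF where
  wires : ℕ

/-- Maps of `TOF`: circuits modulo the defining congruence. -/
abbrev Mor (n m : ℕ) : Type := Quotient (Circ.setoid n m)

namespace Mor

/-- The map of `TOF` presented by a circuit. -/
def mk {n m : ℕ} (f : Circ n m) : Mor n m := Quotient.mk _ f

/-- Composition in `TOF`. -/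
def comp {n m k : ℕ} (f : Mor n m) (g : Mor m k) : Mor n k :=
  Quotient.map₂ Circ.comp (fun _ _ h _ _ h' => Circ.Rel.comp h h') f g

/-- The tensor product of `TOF`. -/
def tensor {n m n' m' : ℕ} (f : Mor n m) (g : Mor n' m') : Mor (n + n') (m + m') :=
  Quotient.map₂ Circ.tensor (fun _ _ h _ _ h' => Circ.Rel.tensor h h') f g

end Mor

open CategoryTheory

instance : Category TOF where
  Hom X Y := Mor X.wires Y.wires
  id X := Mor.mk (Circ.id X.wires)
  comp f g := Mor.comp f g
  id_comp := by rintro X Y ⟨f⟩; exact Quotient.sound (Circ.Rel.id_comp f)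
  comp_id := by rintro X Y ⟨f⟩; exact Quotient.sound (Circ.Rel.comp_id f)
  assoc := by rintro W X Y Z ⟨f⟩ ⟨g⟩ ⟨h⟩; exact Quotient.sound (Circ.Rel.assoc f g h)

/-! ### An evaluation of circuits on lists of bits, used to separate maps of `TOF` -/

namespace Circ

/-- Evaluation of a circuit on lists of bits of the right length. -/
def eval : {n m : ℕ} → Circ n m → List (ZMod 2) → Option (List (ZMod 2))
  | _, _, id _, l => some l
  | _, _, comp f g, l => (eval f l).bind (eval g)
  | _, _, @tensor n _ _ _ f g, l =>
      (eval f (l.take n)).bind fun a => (eval g (l.drop n)).bind fun b => some (a ++ b)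
  | _, _, symm n _, l => some (l.drop n ++ l.take n)
  | _, _, ketOne, _ => some [1]
  | _, _, braOne, l => if l = [1] then some [] else none
  | _, _, tof, l =>
      match l with
      | [a, b, c] => some [a, b, a * b + c]
      | _ => none

theorem eval_cast {n m n' m' : ℕ} (hn : n = n') (hm : m = m') (f : Circ n m) :
    eval (cast hn hm f) = eval f := by
  subst hn hm; rfl

theorem eval_length {n m : ℕ} (f : Circ n m) : ∀ l r : List (ZMod 2), l.length = n →
    eval f l = some r → r.length = m := by
  induction f with
  | id n => intro l r hl h; simp [eval] at h; simp [← h, hl]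
  | comp f g hf hg =>
    intro l r hl h
    simp only [eval, Option.bind_eq_some_iff] at h
    obtain ⟨a, ha, hb⟩ := h
    exact hg a r (hf l a hl ha) hb
  | tensor f g hf hg =>
    intro l r hl h
    simp only [eval, Option.bind_eq_some_iff] at h
    obtain ⟨a, ha, b, hb, hab⟩ := h
    have h1 := hf _ a (by simp [hl]) ha
    have h2 := hg _ b (by simp [hl]) hb
    simp only [Option.some.injEq] at hab
    simp [← hab, h1, h2]
  | symm n m =>
    intro l r hl h
    simp only [eval, Option.some.injEq] at h
    subst h
    simp [hl]
  | ketOne =>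
    intro l r hl h
    simp only [eval, Option.some.injEq] at h
    simp [← h]
  | braOne =>
    intro l r hl h
    simp only [eval] at h
    split_ifs at h
    simp only [Option.some.injEq] at h
    simp [← h]
  | tof =>
    intro l r hl h
    simp only [eval] at h
    split at h
    · simp only [Option.some.injEq] at h
      simp [← h]
    · simp at h

theorem eval_injective {n m : ℕ} (f : Circ n m) : ∀ l l' r : List (ZMod 2), l.length = n →
    l'.length = n → eval f l = some r → eval f l' = some r → l = l' := by
  induction f with
  | id n => intro l l' r hl hl' h h'; simp [eval] at h h'; rw [h, h']
  | comp f g hf hg =>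
    intro l l' r hl hl' h h'
    simp only [eval, Option.bind_eq_some_iff] at h h'
    obtain ⟨a, ha, hb⟩ := h
    obtain ⟨a', ha', hb'⟩ := h'
    have := hg a a' r (eval_length f _ _ hl ha) (eval_length f _ _ hl' ha') hb hb'
    subst this
    exact hf _ _ _ hl hl' ha ha'
  | @tensor n m n' m' f g hf hg =>
    intro l l' r hl hl' h h'
    simp only [eval, Option.bind_eq_some_iff, Option.some.injEq] at h h'
    obtain ⟨a, ha, b, hb, hab⟩ := h
    obtain ⟨a', ha', b', hb', hab'⟩ := h'
    have e1 := eval_length f _ _ (by simp [hl]) ha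
    have e2 := eval_length f _ _ (by simp [hl']) ha'
    obtain ⟨rfl, rfl⟩ := List.append_inj (hab.trans hab'.symm) (e1.trans e2.symm)
    have t := hf _ _ _ (by simp [hl]) (by simp [hl']) ha ha'
    have d := hg _ _ _ (by simp [hl]) (by simp [hl']) hb hb'
    rw [← List.take_append_drop n l, ← List.take_append_drop n l', t, d]
  | symm n m =>
    intro l l' r hl hl' h h'
    simp only [eval, Option.some.injEq] at h h'
    obtain ⟨d, t⟩ := List.append_inj (h.trans h'.symm) (by simp [hl, hl'])
    rw [← List.take_append_drop n l, ← List.take_append_drop n l', t, d]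
  | ketOne =>
    intro l l' r hl hl' h h'
    rw [List.length_eq_zero_iff] at hl hl'
    rw [hl, hl']
  | braOne =>
    intro l l' r hl hl' h h'
    simp only [eval] at h h'
    split_ifs at h h' with p q
    rw [p, q]
  | tof =>
    intro l l' r hl hl' h h'
    simp only [eval] at h h'
    split at h
    · split at h'
      · rw [← h] at h'
        simp only [Option.some.injEq, List.cons.injEq, and_true] at h'
        obtain ⟨rfl, rfl, h3⟩ := h'
        rw [add_left_cancel h3]
      · simp at h'
    · simp at h

theorem eval_ext2 {f g : List (ZMod 2) → Option (List (ZMod 2))}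
    (h : ∀ a b : ZMod 2, f [a, b] = g [a, b]) (l : List (ZMod 2)) (hl : l.length = 2) :
    f l = g l := by
  match l, hl with
  | [a, b], _ => exact h a b

theorem eval_ext3 {f g : List (ZMod 2) → Option (List (ZMod 2))}
    (h : ∀ a b c : ZMod 2, f [a, b, c] = g [a, b, c]) (l : List (ZMod 2)) (hl : l.length = 3) :
    f l = g l := by
  match l, hl with
  | [a, b, c], _ => exact h a b c

theorem eval_ext4 {f g : List (ZMod 2) → Option (List (ZMod 2))}
    (h : ∀ a b c d : ZMod 2, f [a, b, c, d] = g [a, b, c, d]) (l : List (ZMod 2))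
    (hl : l.length = 4) : f l = g l := by
  match l, hl with
  | [a, b, c, d], _ => exact h a b c d

theorem eval_ext5 {f g : List (ZMod 2) → Option (List (ZMod 2))}
    (h : ∀ a b c d e : ZMod 2, f [a, b, c, d, e] = g [a, b, c, d, e]) (l : List (ZMod 2))
    (hl : l.length = 5) : f l = g l := by
  match l, hl with
  | [a, b, c, d, e], _ => exact h a b c d e

/-- The evaluation respects the defining congruence. -/
theorem Rel.eval_eq {n m : ℕ} {f g : Circ n m} (h : Rel f g) :
    ∀ l : List (ZMod 2), l.length = n → eval f l = eval g l := by
  induction h with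
  | refl f => intros; rfl
  | symm _ ih => intro l hl; exact (ih l hl).symm
  | trans _ _ ih ih' => intro l hl; exact (ih l hl).trans (ih' l hl)
  | @comp _ _ _ f f' g g' _ _ ih ih' =>
    intro l hl
    simp only [eval, ← ih l hl]
    cases h : eval f l with
    | none => rfl
    | some a => exact ih' a (eval_length f l a hl h)
  | tensor _ _ ih ih' =>
    intro l hl
    simp only [eval]
    rw [ih _ (by simp [hl]), ih' _ (by simp [hl])]
  | id_comp f => intros; simp [eval]
  | comp_id f => intros; simp only [eval]; exact Option.bind_fun_some _
  | assoc f g h => intros; simp only [eval]; rw [Option.bind_assoc]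
  | tensor_id n m => intros; simp [eval]
  | interchange f g f' g' =>
    intro l hl
    simp only [eval]
    cases h : eval f (l.take _) with
    | none => rfl
    | some a =>
      have ha := eval_length f _ _ (by simp [hl]) h
      simp only [Option.bind_some]
      cases h' : eval f' (l.drop _) with
      | none => simp
      | some b => simp [← ha]
  | @tensor_assoc n m n' m' n'' m'' f g h =>
    intro l hl
    rw [eval_cast]
    simp only [eval, List.take_take, List.drop_take, List.drop_drop, Nat.min_eq_left
      (Nat.le_add_right n n'), Nat.add_sub_cancel_left]
    simp [Option.bind_assoc]
  | tensor_unit f =>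
    intro l hl
    simp only [eval]
    simp only [Nat.add_zero] at hl
    rw [List.take_of_length_le hl.le, List.drop_of_length_le hl.le]
    simp
  | unit_tensor f => intro l hl; rw [eval_cast]; simp [eval]
  | @symm_natural n m n' m' f g =>
    intro l hl
    simp only [eval, Option.bind_some]
    have e1 : (l.drop n ++ l.take n).take n' = l.drop n := by
      rw [List.take_append_of_le_length (by simp [hl]), List.take_of_length_le (by simp [hl])]
    have e2 : (l.drop n ++ l.take n).drop n' = l.take n := by
      have : n' = (l.drop n).length := by simp [hl]
      conv_lhs => rw [this]
      simp
    rw [e1, e2]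
    cases h : eval f (l.take n) with
    | none => simp
    | some a =>
      have ha := eval_length f _ _ (by simp [hl]) h
      cases h' : eval g (l.drop n) with
      | none => simp
      | some b => simp [← ha]
  | symm_symm n m =>
    intro l hl
    have : m = (l.drop n).length := by simp [hl]
    simp only [eval, Option.bind_some]
    conv_lhs => rw [this]
    simp
  | symm_unit n =>
    intro l hl
    rw [eval_cast]
    simp only [eval]
    simp only [Nat.add_zero] at hl
    rw [List.take_of_length_le hl.le, List.drop_of_length_le hl.le]
    simp
  | hexagon n m k =>
    intro l hl
    simp only [eval, eval_cast, Option.bind_some]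
    obtain ⟨a, b, rfl, ha⟩ : ∃ a b, l = a ++ b ∧ a.length = n :=
      ⟨l.take n, l.drop n, by simp, by simp [hl]⟩
    obtain ⟨b, c, rfl, hb⟩ : ∃ b' c, b = b' ++ c ∧ b'.length = m :=
      ⟨b.take m, b.drop m, by simp, by simp at hl; simp; omega⟩
    subst ha hb
    have e1 : (a ++ (b ++ c)).drop (a.length + b.length) = c := by
      rw [← List.append_assoc, ← List.length_append, List.drop_left]
    have e2 : (a ++ (b ++ c)).take (a.length + b.length) = a ++ b := by
      rw [← List.append_assoc, ← List.length_append, List.take_left]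
    simp [e1, e2]
  | tof1 => exact eval_ext2 (by decide)
  | tof1_flip => exact eval_ext3 (by decide)
  | tof2 => exact eval_ext2 (by decide)
  | tof2_flip => exact eval_ext3 (by decide)
  | tof3 => exact eval_ext5 (by decide)
  | tof4 => exact eval_ext5 (by decide)
  | tof5 => exact eval_ext4 (by decide)
  | tof5_5 => exact eval_ext4 (by decide)
  | tof6 => exact eval_ext2 (by decide)
  | tof7 => intro l hl; match l, hl with | [a], _ => revert a; decide
  | tof8 => intro l hl; match l, hl with | [], _ => decide
  | tof9 => exact eval_ext3 (by decide)
  | tof10 => exact eval_ext4 (by decide)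
  | tof11 => exact eval_ext4 (by decide)
  | tof12 => exact eval_ext4 (by decide)
  | tof13 => exact eval_ext4 (by decide)
  | tof14 => exact eval_ext2 (by decide)
  | tof15 => exact eval_ext3 (by decide)
  | tof16 => exact eval_ext4 (by decide)

end Circ

/-! ### Points of `TOF` -/

namespace Mor

theorem mk_comp {n m k : ℕ} (f : Circ n m) (g : Circ m k) : mk (f ⨾ g) = comp (mk f) (mk g) := rfl

theorem mk_tensor {n m n' m' : ℕ} (f : Circ n m) (g : Circ n' m') :
    mk (f ⊠ g) = tensor (mk f) (mk g) := rfl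

theorem id_comp {n m : ℕ} (f : Mor n m) : comp (mk (Circ.id n)) f = f := by
  obtain ⟨f⟩ := f; exact Quotient.sound (Circ.Rel.id_comp f)

theorem comp_id {n m : ℕ} (f : Mor n m) : comp f (mk (Circ.id m)) = f := by
  obtain ⟨f⟩ := f; exact Quotient.sound (Circ.Rel.comp_id f)

theorem assoc {n m k l : ℕ} (f : Mor n m) (g : Mor m k) (h : Mor k l) :
    comp (comp f g) h = comp f (comp g h) := by
  obtain ⟨f⟩ := f; obtain ⟨g⟩ := g; obtain ⟨h⟩ := h
  exact Quotient.sound (Circ.Rel.assoc f g h)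

theorem interchange {n m k n' m' k' : ℕ} (f : Mor n m) (g : Mor m k) (f' : Mor n' m')
    (g' : Mor m' k') :
    comp (tensor f f') (tensor g g') = tensor (comp f g) (comp f' g') := by
  obtain ⟨f⟩ := f; obtain ⟨g⟩ := g; obtain ⟨f'⟩ := f'; obtain ⟨g'⟩ := g'
  exact Quotient.sound (Circ.Rel.interchange f g f' g').symm

local notation:70 f:70 " ⨟ " g:71 => Mor.comp (f :) (g :)
local notation:80 f:80 " ⊛ " g:81 => Mor.tensor (f :) (g :)

/-- The tensor product of points. -/
def pt {n m : ℕ} (p : Mor 0 n) (q : Mor 0 m) : Mor 0 (n + m) := tensor p q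

theorem pt_comp {n m n' m' : ℕ} (p : Mor 0 n) (q : Mor 0 n') (f : Mor n m) (g : Mor n' m') :
    comp (pt p q) (tensor f g) = pt (comp p f) (comp q g) := interchange p f q g

theorem pt_assoc_one {n m : ℕ} (p : Mor 0 n) (q : Mor 0 m) (r : Mor 0 1) :
    pt p (pt q r) = pt (pt p q) r := by
  obtain ⟨p⟩ := p; obtain ⟨q⟩ := q; obtain ⟨r⟩ := r
  exact Quotient.sound (Circ.Rel.tensor_assoc p q r).symm

theorem pt_assoc_zero {n m : ℕ} (p : Mor 0 n) (q : Mor 0 m) (r : Mor 0 0) :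
    pt p (pt q r) = pt (pt p q) r := by
  obtain ⟨p⟩ := p; obtain ⟨q⟩ := q; obtain ⟨r⟩ := r
  exact Quotient.sound (Circ.Rel.tensor_assoc p q r).symm

/-- The unique bit-string of length zero, as a point. -/
def unit : Mor 0 0 := mk (Circ.id 0)

/-- The point `|1⟩`. -/
def one : Mor 0 1 := mk Circ.ketOne

/-- The point `|0⟩`. -/
def zero : Mor 0 1 := mk Circ.ketZero

/-- The scalar `⟨0| ∘ |1⟩`. -/
def scal : Mor 0 0 := mk (Circ.ketOne ⨾ Circ.braZero)

theorem pt_unit {n : ℕ} (p : Mor 0 n) : pt p unit = p := by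
  obtain ⟨p⟩ := p; exact Quotient.sound (Circ.Rel.tensor_unit p)

theorem tensor_id0 {n m : ℕ} (f : Mor n m) : tensor f (mk (Circ.id 0)) = f := by
  obtain ⟨f⟩ := f; exact Quotient.sound (Circ.Rel.tensor_unit f)

theorem unit_pt1 (p : Mor 0 1) : pt unit p = p := by
  obtain ⟨p⟩ := p; exact Quotient.sound (Circ.Rel.unit_tensor p)

theorem id0_tensor10 (f : Mor 1 0) : tensor (mk (Circ.id 0)) f = f := by
  obtain ⟨p⟩ := f; exact Quotient.sound (Circ.Rel.unit_tensor p)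

theorem id0_tensor00 (f : Mor 0 0) : tensor (mk (Circ.id 0)) f = f := by
  obtain ⟨p⟩ := f; exact Quotient.sound (Circ.Rel.unit_tensor p)

theorem id0_tensor33 (f : Mor 3 3) : tensor (mk (Circ.id 0)) f = f := by
  obtain ⟨p⟩ := f; exact Quotient.sound (Circ.Rel.unit_tensor p)

theorem id0_tensor02 (f : Mor 0 2) : tensor (mk (Circ.id 0)) f = f := by
  obtain ⟨p⟩ := f; exact Quotient.sound (Circ.Rel.unit_tensor p)

theorem pt_symm {n m : ℕ} (p : Mor 0 n) (q : Mor 0 m) :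
    comp (pt p q) (mk (Circ.symm n m)) = pt q p := by
  have h0 : mk (Circ.symm 0 0) = mk (Circ.id 0) := Quotient.sound (Circ.Rel.symm_unit 0)
  have : comp (pt p q) (mk (Circ.symm n m)) = comp (mk (Circ.symm 0 0)) (pt q p) := by
    obtain ⟨p⟩ := p; obtain ⟨q⟩ := q
    exact Quotient.sound (Circ.Rel.symm_natural p q)
  rw [this, h0, id_comp]

theorem comm_one (s : Mor 0 0) (p : Mor 0 1) : pt s p = pt p s := by
  have h0 : mk (Circ.symm 1 0) = mk (Circ.id 1) := Quotient.sound (Circ.Rel.symm_unit 1)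
  have := pt_symm p s
  rw [h0] at this
  exact this.symm.trans (comp_id _)

/-- Three bits on three wires. -/
def pt3 (a b c : Mor 0 1) : Mor 0 3 := pt (pt a b) c

theorem pt3_eq (a b c : Mor 0 1) : pt3 a b c = pt a (pt b c) := (pt_assoc_one a b c).symm

theorem one_bra : comp one (mk Circ.braOne) = unit := Quotient.sound Circ.Rel.tof8

theorem scal_eq : comp zero (mk Circ.braOne) = scal :=
  assoc (mk Circ.ketOne) (mk Circ.not) (mk Circ.braOne)

theorem scal_sq_aux (s : Mor 0 0) (p : Mor 0 1) : s ⨟ p = pt s p := by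
  have : (s ⊛ mk (Circ.id 0)) ⨟ (mk (Circ.id 0) ⊛ p) = s ⨟ p := by
    rw [tensor_id0]; congr 1; exact unit_pt1 p
  rw [← this, interchange, comp_id]
  congr 1
  exact id_comp p

theorem tensor_pt2 (a : Mor 0 1) (q : Mor 0 2) : q ⨟ (a ⊛ mk (Circ.id 2)) = pt a q := by
  have h : comp (pt unit q) (a ⊛ mk (Circ.id 2)) = pt a q := by
    rw [pt_comp, comp_id]; unfold unit; rw [id_comp]
  rw [← h]; congr 1; exact (id0_tensor02 _).symm

theorem tensor_pt1 (a q : Mor 0 1) : q ⨟ (a ⊛ mk (Circ.id 1)) = pt a q := by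
  have h : comp (pt unit q) (a ⊛ mk (Circ.id 1)) = pt a q := by
    rw [pt_comp, comp_id]; unfold unit; rw [id_comp]
  rw [← h, unit_pt1]

theorem one_bra_zero : one ⨟ mk Circ.braZero = scal := rfl

theorem tof_one (b c : Mor 0 1) :
    pt3 one b c ⨟ mk Circ.tof = pt one (pt b c ⨟ mk Circ.cnot) := by
  have h : (one ⊛ mk (Circ.id 2)) ⨟ mk Circ.tof = one ⊛ mk Circ.cnot :=
    Quotient.sound Circ.Rel.tof1
  have h3 : pt one (pt b c ⨟ mk Circ.cnot) = comp (pt unit (pt b c)) (one ⊛ mk Circ.cnot) := by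
    rw [pt_comp]; unfold unit; rw [id_comp]
  rw [pt3_eq, ← tensor_pt2, assoc, h, h3]; congr 1; exact (id0_tensor02 _).symm

theorem tof_zero (b c : Mor 0 1) : pt3 zero b c ⨟ mk Circ.tof = pt3 zero b c := by
  have h : (zero ⊛ mk (Circ.id 2)) ⨟ mk Circ.tof = zero ⊛ mk (Circ.id 2) :=
    Quotient.sound Circ.Rel.tof2
  rw [pt3_eq, ← tensor_pt2, assoc, h]

theorem swap12 (a b c : Mor 0 1) : pt3 a b c ⨟ (mk Circ.swap ⊛ mk (Circ.id 1)) = pt3 b a c := by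
  rw [pt3]
  refine (pt_comp _ _ _ _).trans ?_
  rw [comp_id]; unfold Circ.swap
  exact congrArg (fun q => pt q c) (pt_symm a b)

theorem tof_swap (a b c : Mor 0 1) : pt3 a b c ⨟ mk Circ.tof =
    pt3 b a c ⨟ mk Circ.tof ⨟ (mk Circ.swap ⊛ mk (Circ.id 1)) := by
  have h : mk Circ.tof = (mk Circ.swap ⊛ mk (Circ.id 1)) ⨟ mk Circ.tof ⨟
    (mk Circ.swap ⊛ mk (Circ.id 1)) := Quotient.sound Circ.Rel.tof15
  conv_lhs => rw [h, ← assoc, ← assoc, swap12]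

theorem tof_one_zero (c : Mor 0 1) : pt3 one zero c ⨟ mk Circ.tof = pt3 one zero c := by
  rw [tof_swap, tof_zero, swap12]

theorem swap_bra : mk Circ.swap ⨟ (mk Circ.braOne ⊛ mk (Circ.id 1)) =
    mk (Circ.id 1) ⊛ mk Circ.braOne := by
  have h0 : mk (Circ.symm 1 0) = mk (Circ.id 1) := Quotient.sound (Circ.Rel.symm_unit 1)
  have h : (mk (Circ.id 1) ⊛ mk Circ.braOne) ⨟ mk (Circ.symm 1 0) =
      mk (Circ.symm 1 1) ⨟ (mk Circ.braOne ⊛ mk (Circ.id 1)) :=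
    Quotient.sound (Circ.Rel.symm_natural (Circ.id 1) Circ.braOne)
  rw [h0] at h
  exact h.symm.trans (comp_id _)

theorem tof_one_one (c : Mor 0 1) :
    pt3 one one c ⨟ mk Circ.tof = pt3 one one (c ⨟ mk Circ.not) := by
  have hA : c ⨟ mk Circ.not =
      pt one c ⨟ mk Circ.cnot ⨟ (mk Circ.braOne ⊛ mk (Circ.id 1)) := by
    rw [← tensor_pt1]
    change c ⨟ (((one ⊛ mk (Circ.id 1)) ⨟ mk Circ.cnot) ⨟
      (mk Circ.braOne ⊛ mk (Circ.id 1))) = _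
    rw [← assoc, ← assoc]
  have h1 := tof_swap one one c
  rw [tof_one] at h1 ⊢
  rw [pt3_eq, hA]
  generalize pt one c ⨟ mk Circ.cnot = X at h1 ⊢
  have h2 := congrArg (fun q : Mor 0 3 => q ⨟ (mk Circ.braOne ⊛ mk (Circ.id 2))) h1
  have h3 : pt one X ⨟ (mk Circ.braOne ⊛ mk (Circ.id 2)) = X := by
    refine (pt_comp _ _ _ _).trans ?_
    rw [one_bra, comp_id]; exact id0_tensor02 _
  have e1 : mk Circ.braOne ⊛ mk (Circ.id 2) =
      (mk Circ.braOne ⊛ mk (Circ.id 1)) ⊛ mk (Circ.id 1) := by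
    have : mk (Circ.id 2) = mk (Circ.id 1) ⊛ mk (Circ.id 1) :=
      Quotient.sound (Circ.Rel.tensor_id 1 1).symm
    rw [this]
    exact Quotient.sound (Circ.Rel.tensor_assoc Circ.braOne (Circ.id 1) (Circ.id 1)).symm
  have e2 : (mk (Circ.id 1) ⊛ mk Circ.braOne) ⊛ mk (Circ.id 1) =
      mk (Circ.id 1) ⊛ (mk Circ.braOne ⊛ mk (Circ.id 1)) :=
    Quotient.sound (Circ.Rel.tensor_assoc (Circ.id 1) Circ.braOne (Circ.id 1))
  have hsw : (mk Circ.swap ⊛ mk (Circ.id 1)) ⨟ (mk Circ.braOne ⊛ mk (Circ.id 2)) =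
      mk (Circ.id 1) ⊛ (mk Circ.braOne ⊛ mk (Circ.id 1)) := by
    rw [e1]
    refine (interchange _ _ _ _).trans ?_
    rw [comp_id, ← e2]
    exact congrArg (fun q => tensor q (mk (Circ.id 1))) swap_bra
  have h4 : pt one X ⨟ (mk Circ.swap ⊛ mk (Circ.id 1)) ⨟ (mk Circ.braOne ⊛ mk (Circ.id 2)) =
      pt one (X ⨟ (mk Circ.braOne ⊛ mk (Circ.id 1))) := by
    rw [assoc, hsw]
    refine (pt_comp one X _ _).trans ?_
    rw [comp_id]
  have h5 : X = pt one (X ⨟ (mk Circ.braOne ⊛ mk (Circ.id 1))) := h3.symm.trans (h2.trans h4)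
  exact congrArg (pt one) h5

theorem one_not : one ⨟ mk Circ.not = zero := rfl

theorem cancel_one_one {p q : Mor 0 1} (h : pt3 one one p = pt3 one one q) : p = q := by
  have key : ∀ p : Mor 0 1, pt3 one one p ⨟
      ((mk Circ.braOne ⊛ mk Circ.braOne) ⊛ mk (Circ.id 1)) = p := by
    intro p
    refine (pt_comp _ _ _ _).trans ?_
    rw [comp_id]
    have : pt one one ⨟ (mk Circ.braOne ⊛ mk Circ.braOne) = unit := by
      refine (pt_comp _ _ _ _).trans ?_
      rw [one_bra]; exact pt_unit unit
    exact (congrArg (fun q => pt q p) this).trans (unit_pt1 p)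
  rw [← key p, h, key q]

theorem zero_not : zero ⨟ mk Circ.not = one := by
  apply cancel_one_one
  have h9 : mk Circ.tof ⨟ mk Circ.tof = mk (Circ.id 3) := Quotient.sound Circ.Rel.tof9
  rw [← tof_one_one, ← one_not, ← tof_one_one, assoc, h9, comp_id]

theorem zero_braZero : zero ⨟ mk Circ.braZero = unit := by
  change zero ⨟ (mk Circ.not ⨟ mk Circ.braOne) = unit
  rw [← assoc, zero_not, one_bra]

/-! Powers of the scalar. -/

theorem scal_cut (p : Mor 0 1) : pt scal p = pt (pt scal (p ⨟ mk Circ.braOne)) one := by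
  have h7 : scal ⊛ mk (Circ.id 1) = scal ⊛ (mk Circ.braOne ⨟ one) := Quotient.sound Circ.Rel.tof7
  have e : ∀ f : Mor 1 1, pt unit p ⨟ (scal ⊛ f) = pt scal (p ⨟ f) := by
    intro f
    refine (pt_comp _ _ _ _).trans ?_
    unfold unit; rw [id_comp]
  have := congrArg (fun q : Mor 1 1 => comp (pt unit p) q) h7
  have h2 := (e _).symm.trans (this.trans (e _))
  rw [comp_id, ← assoc, scal_sq_aux, pt_assoc_one] at h2
  exact h2

theorem scal_cube : scal = pt (pt scal scal) scal := by
  have h := scal_cut zero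
  rw [scal_eq] at h
  have h2 := congrArg (fun q : Mor 0 1 => q ⨟ (mk (Circ.id 0) ⊛ mk Circ.braZero)) h
  have l : pt scal zero ⨟ (mk (Circ.id 0) ⊛ mk Circ.braZero) = scal := by
    refine (pt_comp _ _ _ _).trans ?_
    rw [comp_id, zero_braZero, pt_unit]
  have r : pt (pt scal scal) one ⨟ (mk (Circ.id 0) ⊛ mk Circ.braZero) =
      pt (pt scal scal) scal := by
    refine (pt_comp _ _ _ _).trans ?_
    rw [comp_id, one_bra_zero]
  exact l.symm.trans (h2.trans r)

theorem scal_pt2 (s : Mor 0 0) (a b : Mor 0 1) : pt s (pt a b) = pt (pt a b) s := by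
  have e1 : pt s (pt a b) = pt (pt s a) b := pt_assoc_one s a b
  have e2 : pt (pt a s) b = pt a (pt s b) := (pt_assoc_one a s b).symm
  have e3 : pt a (pt b s) = pt (pt a b) s := pt_assoc_zero a b s
  rw [comm_one] at e1
  rw [comm_one s b] at e2
  exact e1.trans (e2.trans e3)

theorem scal_pt3 (s : Mor 0 0) (a b c : Mor 0 1) :
    pt s (pt3 a b c) = pt (pt a b) (pt s c) := by
  have e1 : pt s (pt3 a b c) = pt (pt s (pt a b)) c := pt_assoc_one s (pt a b) c
  have e2 : pt (pt a b) (pt s c) = pt (pt (pt a b) s) c := pt_assoc_one (pt a b) s c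
  exact e1.trans ((congrArg (fun q : Mor 0 2 => (pt q c : Mor 0 3)) (scal_pt2 s a b)).trans e2.symm)

theorem scal_tof (s : Mor 0 0) (p : Mor 0 3) :
    comp (pt s p) (mk Circ.tof) = pt s (p ⨟ mk Circ.tof) := by
  have : pt s p ⨟ (mk (Circ.id 0) ⊛ mk Circ.tof) = pt s (p ⨟ mk Circ.tof) := by
    refine (pt_comp _ _ _ _).trans ?_
    rw [comp_id]
  rw [← this]
  congr 1
  exact (id0_tensor33 _).symm

theorem scal_bra (s : Mor 0 0) (p : Mor 0 1) :
    comp (pt s p) (mk Circ.braOne) = pt s (p ⨟ mk Circ.braOne) := by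
  have : pt s p ⨟ (mk (Circ.id 0) ⊛ mk Circ.braOne) = pt s (p ⨟ mk Circ.braOne) := by
    refine (pt_comp _ _ _ _).trans ?_
    rw [comp_id]
  rw [← this]
  congr 1
  exact (id0_tensor10 _).symm

theorem scal_idem : pt scal scal = scal := by
  have hz : pt scal zero = pt (pt scal scal) one := by
    have h := scal_cut zero
    rwa [scal_eq] at h
  have a1 : (pt scal (pt3 zero one one) : Mor 0 3) = pt (pt scal scal) (pt3 one one one) := by
    have e1 : pt scal (pt3 zero one one) = pt (pt scal (pt zero one)) one :=
      pt_assoc_one scal (pt zero one) one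
    have e2 : pt scal (pt zero one) = pt (pt scal zero) one := pt_assoc_one scal zero one
    have e3 : pt (pt scal scal) (pt3 one one one) = pt (pt (pt scal scal) (pt one one)) one :=
      pt_assoc_one (pt scal scal) (pt one one) one
    have e4 : pt (pt scal scal) (pt one one) = pt (pt (pt scal scal) one) one :=
      pt_assoc_one (pt scal scal) one one
    rw [hz] at e2
    exact e1.trans ((congrArg (fun q : Mor 0 2 => (pt q one : Mor 0 3)) (e2.trans e4.symm)).trans
      e3.symm)
  have a2 := congrArg (fun q : Mor 0 3 => q ⨟ mk Circ.tof) a1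
  have a3 := (scal_tof _ _).symm.trans (a2.trans (scal_tof _ _))
  rw [tof_zero, tof_one_one, one_not] at a3
  have a4 := (scal_pt3 _ _ _ _).symm.trans ((a1.symm.trans a3).trans (scal_pt3 _ _ _ _))
  have a5 : pt (pt scal scal) one = pt (pt scal scal) zero := cancel_one_one a4
  have a6 := congrArg (fun q : Mor 0 1 => q ⨟ mk Circ.braOne) a5
  have a7 := (scal_bra _ _).symm.trans (a6.trans (scal_bra _ _))
  rw [one_bra, scal_eq, pt_unit, ← scal_cube] at a7
  exact a7

theorem scal_zero : pt scal zero = pt scal one := by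
  have h := scal_cut zero
  rwa [scal_eq, scal_idem] at h

/-- The point `|b⟩` given by a bit. -/
def bit (b : ZMod 2) : Mor 0 1 := if b = 1 then one else zero

/-- The point `|b₁, …, bₙ⟩` given by a string of bits. -/
def ket : (n : ℕ) → (Fin n → ZMod 2) → Mor 0 n
  | 0, _ => unit
  | n + 1, b => pt (ket n fun i => b i.castSucc) (bit (b (Fin.last n)))

/-- The degenerate point: the scalar `⟨0| ∘ |1⟩` next to `|1, …, 1⟩`. -/
def omega : (n : ℕ) → Mor 0 n
  | 0 => scal
  | n + 1 => pt (omega n) one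

theorem omega_scal : ∀ n : ℕ, pt (omega n) scal = omega n
  | 0 => scal_idem
  | n + 1 => by
    have e1 : pt (pt (omega n) one) scal = pt (omega n) (pt one scal) :=
      (pt_assoc_zero _ _ _).symm
    have e2 : pt (omega n) (pt scal one) = pt (pt (omega n) scal) one := pt_assoc_one _ _ _
    rw [omega_scal n] at e2
    rw [comm_one] at e2
    exact e1.trans e2

theorem omega_zero (n : ℕ) : pt (omega n) zero = omega (n + 1) := by
  have e1 : pt (omega n) (pt scal zero) = pt (pt (omega n) scal) zero := pt_assoc_one _ _ _
  have e2 : pt (omega n) (pt scal one) = pt (pt (omega n) scal) one := pt_assoc_one _ _ _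
  rw [omega_scal] at e1 e2
  rw [scal_zero] at e1
  exact e1.symm.trans e2

theorem omega_bit (n : ℕ) (b : ZMod 2) : pt (omega n) (bit b) = omega (n + 1) := by
  unfold bit
  split_ifs
  · rfl
  · exact omega_zero n

theorem omega_ket (n : ℕ) : ∀ (m : ℕ) (b : Fin m → ZMod 2), pt (omega n) (ket m b) = omega (n + m)
  | 0, _ => pt_unit _
  | m + 1, b => by
    have e : pt (omega n) (pt (ket m fun i => b i.castSucc) (bit (b (Fin.last m)))) =
      pt (pt (omega n) (ket m fun i => b i.castSucc)) (bit (b (Fin.last m))) := pt_assoc_one _ _ _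
    rw [omega_ket n m, omega_bit] at e
    exact e

theorem omega_omega (n : ℕ) : ∀ m : ℕ, pt (omega n) (omega m) = omega (n + m)
  | 0 => omega_scal n
  | m + 1 => by
    have e : pt (omega n) (pt (omega m) one) = pt (pt (omega n) (omega m)) one :=
      pt_assoc_one _ _ _
    rw [omega_omega n m] at e
    exact e

theorem ket_scal : ∀ (n : ℕ) (b : Fin n → ZMod 2), pt (ket n b) scal = omega n
  | 0, _ => (id0_tensor00 scal : _)
  | n + 1, b => by
    have e1 : pt (pt (ket n fun i => b i.castSucc) (bit (b (Fin.last n)))) scal =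
      pt (ket n fun i => b i.castSucc) (pt (bit (b (Fin.last n))) scal) :=
      (pt_assoc_zero _ _ _).symm
    have e2 : pt (ket n fun i => b i.castSucc) (pt scal (bit (b (Fin.last n)))) =
      pt (pt (ket n fun i => b i.castSucc) scal) (bit (b (Fin.last n))) := pt_assoc_one _ _ _
    rw [ket_scal n, comm_one] at e2
    exact e1.trans (e2.trans (omega_bit n _))

theorem ket_omega (n : ℕ) (b : Fin n → ZMod 2) : ∀ m : ℕ, pt (ket n b) (omega m) = omega (n + m)
  | 0 => ket_scal n b
  | m + 1 => by
    have e : pt (ket n b) (pt (omega m) one) = pt (pt (ket n b) (omega m)) one :=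
      pt_assoc_one _ _ _
    rw [ket_omega n b m] at e
    exact e

theorem ket_ket (n : ℕ) (b : Fin n → ZMod 2) : ∀ (m : ℕ) (c : Fin m → ZMod 2),
    pt (ket n b) (ket m c) = ket (n + m) (Fin.append b c)
  | 0, c => by
    have : Fin.append b c = b := by
      funext i; exact Fin.append_left b c i
    rw [this]
    exact pt_unit _
  | m + 1, c => by
    have e : pt (ket n b) (pt (ket m fun i => c i.castSucc) (bit (c (Fin.last m)))) =
      pt (pt (ket n b) (ket m fun i => c i.castSucc)) (bit (c (Fin.last m))) :=
      pt_assoc_one _ _ _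
    rw [ket_ket n b m] at e
    refine e.trans ?_
    have h1 : (fun i : Fin (n + m) => Fin.append b c (Fin.castSucc i)) =
        Fin.append b fun i => c i.castSucc := by
      funext i
      refine Fin.addCases (fun i => ?_) (fun i => ?_) i
      · rw [Fin.append_left]; exact Fin.append_left b c i
      · rw [Fin.append_right]; exact Fin.append_right b c i.castSucc
    have h2 : Fin.append b c (Fin.last (n + m)) = c (Fin.last m) :=
      Fin.append_right b c (Fin.last m)
    change _ = pt (ket (n + m) fun i => Fin.append b c (Fin.castSucc i))
      (bit (Fin.append b c (Fin.last (n + m))))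
    rw [h1, h2]

/-- A point is good when it is a bit-string or degenerate. -/
def Good {n : ℕ} (p : Mor 0 n) : Prop := (∃ b : Fin n → ZMod 2, p = ket n b) ∨ p = omega n

theorem Good.pt {n m : ℕ} {p : Mor 0 n} {q : Mor 0 m} (hp : Good p) (hq : Good q) :
    Good (pt p q) := by
  rcases hp with ⟨b, rfl⟩ | rfl <;> rcases hq with ⟨c, rfl⟩ | rfl
  · exact Or.inl ⟨_, ket_ket n b m c⟩
  · exact Or.inr (ket_omega n b m)
  · exact Or.inr (omega_ket n m c)
  · exact Or.inr (omega_omega n m)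

theorem good_bit (b : ZMod 2) : Good (bit b) := by
  refine Or.inl ⟨fun _ => b, ?_⟩
  exact (unit_pt1 (bit b)).symm

theorem ket_split {n m : ℕ} (b : Fin (n + m) → ZMod 2) : ket (n + m) b =
    pt (ket n fun i => b (Fin.castAdd m i)) (ket m fun i => b (Fin.natAdd n i)) := by
  rw [ket_ket, Fin.append_castAdd_natAdd]

theorem good_one : Good one := good_bit 1

theorem good_zero : Good zero := good_bit 0

theorem omega_comp_and_good {n m : ℕ} (f : Circ n m) :
    omega n ⨟ mk f = omega m ∧ ∀ b, Good (ket n b ⨟ mk f) := by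
  induction f with
  | id n => exact ⟨comp_id _, fun b => Or.inl ⟨b, comp_id _⟩⟩
  | comp f g hf hg =>
    refine ⟨?_, fun b => ?_⟩
    · rw [mk_comp, ← assoc, hf.1, hg.1]
    · rw [mk_comp, ← assoc]
      rcases hf.2 b with ⟨c, hc⟩ | hc
      · rw [hc]; exact hg.2 c
      · rw [hc, hg.1]; exact Or.inr rfl
  | @tensor n m n' m' f g hf hg =>
    refine ⟨?_, fun b => ?_⟩
    · rw [mk_tensor, ← omega_omega, pt_comp, hf.1, hg.1, omega_omega]
    · rw [mk_tensor, ket_split, pt_comp]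
      exact (hf.2 _).pt (hg.2 _)
  | symm n m =>
    refine ⟨?_, fun b => ?_⟩
    · rw [← omega_omega, pt_symm, omega_omega]
    · rw [ket_split, pt_symm]
      exact Good.pt (Or.inl ⟨_, rfl⟩) (Or.inl ⟨_, rfl⟩)
  | ketOne =>
    refine ⟨scal_sq_aux scal one, fun b => ?_⟩
    have : ket 0 b ⨟ mk Circ.ketOne = one := id_comp _
    rw [this]
    exact good_one
  | braOne =>
    refine ⟨?_, fun b => ?_⟩
    · refine (scal_bra scal one).trans ?_
      rw [one_bra]; exact pt_unit _
    · have : ket 1 b = bit (b 0) := unit_pt1 _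
      rw [this]
      unfold bit
      split_ifs
      · rw [one_bra]; exact Or.inl ⟨fun i => 0, rfl⟩
      · rw [scal_eq]; exact Or.inr rfl
  | tof =>
    refine ⟨?_, fun b => ?_⟩
    · have e1 : pt scal (pt3 one one one) = omega 3 := by
        have e1 : pt scal (pt3 one one one) = pt (pt scal (pt one one)) one :=
          pt_assoc_one scal (pt one one) one
        have e2 : pt scal (pt one one) = pt (pt scal one) one := pt_assoc_one scal one one
        exact e1.trans (congrArg (fun q : Mor 0 2 => (pt q one : Mor 0 3)) e2)
      have e2 : pt scal (pt3 one one zero) = omega 3 := by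
        have e1 : pt scal (pt3 one one zero) = pt (pt scal (pt one one)) zero :=
          pt_assoc_one scal (pt one one) zero
        have e2 : pt scal (pt one one) = pt (pt scal one) one := pt_assoc_one scal one one
        exact e1.trans ((congrArg (fun q : Mor 0 2 => (pt q zero : Mor 0 3)) e2).trans
          (omega_zero 2))
      have e3 := congrArg (fun q : Mor 0 3 => q ⨟ mk Circ.tof) e1
      have e4 := e3.symm.trans (scal_tof _ _)
      rw [tof_one_one, one_not] at e4
      exact e4.trans e2
    · have hb : ket 3 b = pt3 (bit (b 0)) (bit (b 1)) (bit (b 2)) := by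
        have : ket 1 (fun i => b (Fin.castSucc (Fin.castSucc i))) = bit (b 0) := unit_pt1 _
        change pt (pt (ket 1 (fun i => b (Fin.castSucc (Fin.castSucc i)))) _) _ = _
        rw [this]; rfl
      have g3 : ∀ p q r : Mor 0 1, Good p → Good q → Good r → Good (pt3 p q r) :=
        fun p q r hp hq hr => (hp.pt hq).pt hr
      rw [hb]
      have hx := good_bit (b 0)
      have hy := good_bit (b 1)
      have hz := good_bit (b 2)
      by_cases h0 : b 0 = 1
      · have h0' : bit (b 0) = one := if_pos h0
        by_cases h1 : b 1 = 1
        · have h1' : bit (b 1) = one := if_pos h1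
          rw [h0', h1', tof_one_one]
          refine g3 _ _ _ good_one good_one ?_
          by_cases h2 : b 2 = 1
          · have h2' : bit (b 2) = one := if_pos h2
            rw [h2', one_not]; exact good_zero
          · have h2' : bit (b 2) = zero := if_neg h2
            rw [h2', zero_not]; exact good_one
        · have h1' : bit (b 1) = zero := if_neg h1
          rw [h0', h1', tof_one_zero]
          exact g3 _ _ _ good_one good_zero hz
      · have h0' : bit (b 0) = zero := if_neg h0
        rw [h0', tof_zero]
        exact g3 _ _ _ good_zero hy hz

theorem good {n : ℕ} (p : Mor 0 n) : Good p := by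
  obtain ⟨f⟩ := p
  have h := (omega_comp_and_good f).2 Fin.elim0
  have : ket 0 Fin.elim0 ⨟ mk f = mk f := id_comp _
  rw [this] at h
  exact h

theorem omega_comp {n m : ℕ} (f : Mor n m) : omega n ⨟ f = omega m := by
  obtain ⟨f⟩ := f
  exact (omega_comp_and_good f).1

/-! ### Total points -/

/-- A map `f` of `TOF` is total when its restriction `f f°` is an identity, where `f°` is obtained
by flipping horizontally a circuit that presents `f`. In the inverse category `TOF` the map `f°` is
the partial inverse of `f`, so the condition does not depend on the circuit chosen. -/
def IsTotal {n m : ℕ} (f : Mor n m) : Prop :=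
  ∃ c : Circ n m, mk c = f ∧ mk (c ⨾ c.dag) = mk (Circ.id n)

theorem eval_mk_eq {n m : ℕ} {f g : Circ n m} (h : mk f = mk g) (l : List (ZMod 2))
    (hl : l.length = n) : f.eval l = g.eval l :=
  Circ.Rel.eval_eq (Quotient.exact h) l hl

/-- A circuit presenting `|b₁, …, bₙ⟩`. -/
def ketCirc : (n : ℕ) → (Fin n → ZMod 2) → Circ 0 n
  | 0, _ => Circ.id 0
  | n + 1, b => Circ.tensor (ketCirc n fun i => b i.castSucc)
      (if b (Fin.last n) = 1 then Circ.ketOne else Circ.ketZero)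

theorem mk_ketCirc : ∀ (n : ℕ) (b : Fin n → ZMod 2), mk (ketCirc n b) = ket n b
  | 0, _ => rfl
  | n + 1, b => by
    unfold ketCirc ket bit
    rw [← mk_ketCirc n]
    split_ifs <;> rfl

theorem eval_ketCirc : ∀ (n : ℕ) (b : Fin n → ZMod 2), (ketCirc n b).eval [] = some (List.ofFn b)
  | 0, _ => rfl
  | n + 1, b => by
    rw [List.ofFn_succ']
    simp only [ketCirc, Circ.eval, List.take_nil, List.drop_nil, eval_ketCirc n, Option.bind_some,
      List.concat_eq_append]
    split_ifs with h
    · rw [h]; rfl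
    · have h0 : ∀ x : ZMod 2, x ≠ 1 → x = 0 := by decide
      rw [h0 _ h]; rfl

/-- A circuit presenting the degenerate point. -/
def omegaCirc : (n : ℕ) → Circ 0 n
  | 0 => Circ.ketOne ⨾ Circ.braZero
  | n + 1 => Circ.tensor (omegaCirc n) Circ.ketOne

theorem mk_omegaCirc : ∀ n : ℕ, mk (omegaCirc n) = omega n
  | 0 => rfl
  | n + 1 => by unfold omegaCirc omega; rw [← mk_omegaCirc n]; rfl

theorem eval_omegaCirc : ∀ n : ℕ, (omegaCirc n).eval [] = none
  | 0 => by decide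
  | n + 1 => by simp [omegaCirc, Circ.eval, eval_omegaCirc n]

theorem bit_dag (b : ZMod 2) :
    mk ((if b = 1 then Circ.ketOne else Circ.ketZero) ⨾
      (if b = 1 then Circ.ketOne else Circ.ketZero : Circ 0 1).dag) = unit := by
  split_ifs
  · exact one_bra
  · have : mk (Circ.dag Circ.ketZero) = mk Circ.braZero := by
      have hc : mk Circ.cnot.dag = mk Circ.cnot :=
        (assoc (one ⊛ mk (Circ.id 2)) (mk Circ.tof) (mk Circ.braOne ⊛ mk (Circ.id 2))).symm
      have hn : mk Circ.not.dag = mk Circ.not := by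
        change (one ⊛ mk (Circ.id 1)) ⨟ (mk Circ.cnot.dag ⨟ (mk Circ.braOne ⊛ mk (Circ.id 1))) = _
        rw [hc, ← assoc]; rfl
      change mk Circ.not.dag ⨟ mk Circ.braOne = _
      rw [hn]; rfl
    rw [mk_comp, this]
    exact zero_braZero

theorem isTotal_ket : ∀ (n : ℕ) (b : Fin n → ZMod 2), IsTotal (ket n b) := by
  intro n b
  refine ⟨ketCirc n b, mk_ketCirc n b, ?_⟩
  induction n with
  | zero => exact comp_id (mk (Circ.id 0))
  | succ n ih =>
    have h := interchange (mk (ketCirc n fun i => b i.castSucc))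
      (mk (ketCirc n fun i => b i.castSucc).dag)
      (mk (if b (Fin.last n) = 1 then Circ.ketOne else Circ.ketZero))
      (mk (if b (Fin.last n) = 1 then Circ.ketOne else Circ.ketZero : Circ 0 1).dag)
    refine h.trans ?_
    rw [← mk_comp, ← mk_comp, ih, bit_dag]
    exact pt_unit unit

theorem not_isTotal_omega (n : ℕ) : ¬ IsTotal (omega n) := by
  rintro ⟨c, hc, ht⟩
  rw [← mk_omegaCirc] at hc
  have h1 := eval_mk_eq hc [] rfl
  have h2 := eval_mk_eq ht [] rfl
  rw [eval_omegaCirc] at h1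
  simp [Circ.eval, h1] at h2

theorem isTotal_point_iff {n : ℕ} (p : Mor 0 n) : IsTotal p ↔ ∃ b, p = ket n b := by
  constructor
  · intro h
    rcases good p with hb | rfl
    · exact hb
    · exact absurd h (not_isTotal_omega n)
  · rintro ⟨b, rfl⟩
    exact isTotal_ket n b

theorem ket_injective (n : ℕ) : Function.Injective (ket n) := by
  intro b c h
  rw [← mk_ketCirc, ← mk_ketCirc] at h
  have := eval_mk_eq h [] rfl
  rw [eval_ketCirc, eval_ketCirc] at this
  exact List.ofFn_injective (Option.some.inj this)

theorem isTotal_of_comp {n m : ℕ} (p : Mor 0 n) (f : Mor n m) (h : IsTotal (p ⨟ f)) :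
    IsTotal p := by
  rcases good p with ⟨b, rfl⟩ | rfl
  · exact isTotal_ket n b
  · rw [omega_comp] at h
    exact absurd h (not_isTotal_omega m)

theorem point_comp_injective {n m : ℕ} (f : Mor n m) (p q : Mor 0 n) (hp : IsTotal (p ⨟ f))
    (h : p ⨟ f = q ⨟ f) : p = q := by
  have hq : IsTotal (q ⨟ f) := h ▸ hp
  obtain ⟨b, rfl⟩ := (isTotal_point_iff p).1 (isTotal_of_comp p f hp)
  obtain ⟨c, rfl⟩ := (isTotal_point_iff q).1 (isTotal_of_comp q f hq)
  obtain ⟨d, hd⟩ := (isTotal_point_iff _).1 hp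
  obtain ⟨f⟩ := f
  have hd' := h.symm.trans hd
  rw [← mk_ketCirc n, ← mk_ketCirc] at hd hd'
  have e1 := eval_mk_eq (f := ketCirc n b ⨾ f) hd [] rfl
  have e2 := eval_mk_eq (f := ketCirc n c ⨾ f) hd' [] rfl
  simp only [Circ.eval, eval_ketCirc, Option.bind_some] at e1 e2
  have := Circ.eval_injective f _ _ _ (by simp) (by simp) e1 e2
  rw [List.ofFn_injective this]

end Mor

/-! ### Partial isomorphisms of sets -/

/-- The category of sets and partial isomorphisms. -/
structure Pinj where
  carrier : Type

instance : Category Pinj where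
  Hom X Y := X.carrier ≃. Y.carrier
  id X := PEquiv.refl X.carrier
  comp f g := PEquiv.trans f g
  id_comp f := PEquiv.refl_trans f
  comp_id f := PEquiv.trans_refl f
  assoc f g h := PEquiv.trans_assoc f g h

/-- The set of bit-strings of length `n`, the `n`-th power of the two element set. -/
def bitStrings (n : ℕ) : Pinj := ⟨Fin n → ZMod 2⟩

/-- The full subcategory of `Pinj` on the finite powers of the two element set. -/
abbrev FPinj2 : Type := InducedCategory Pinj bitStrings

/-- The set of total points of an object of `TOF`. -/
abbrev TotalPoint (n : ℕ) : Type := {p : Mor 0 n // p.IsTotal}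

open Classical in
/-- A map `f` sends the total point `p` to the composite of `p` and `f` when that is total, and is
undefined at `p` otherwise. -/
noncomputable def onPoints {n m : ℕ} (f : Mor n m) : TotalPoint n ≃. TotalPoint m where
  toFun p := if h : (Mor.comp p.1 f).IsTotal then some ⟨Mor.comp p.1 f, h⟩ else none
  invFun q := if h : ∃ p : TotalPoint n, Mor.comp p.1 f = q.1 then some h.choose else none
  inv p q := by
    constructor
    · intro h
      change _ = _ at h
      split_ifs at h with hp
      have hc := hp.choose_spec
      rw [Option.some.inj h] at hc
      have ht : (Mor.comp p.1 f).IsTotal := hc ▸ q.2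
      rw [dif_pos ht]
      exact congrArg some (Subtype.ext hc)
    · intro h
      change _ = _ at h
      split_ifs at h with hp
      have hq : Mor.comp p.1 f = q.1 := congrArg Subtype.val (Option.some.inj h)
      have he : ∃ p : TotalPoint n, Mor.comp p.1 f = q.1 := ⟨p, hq⟩
      rw [dif_pos he]
      refine congrArg some (Subtype.ext ?_)
      refine Mor.point_comp_injective f _ _ ?_ (he.choose_spec.trans hq.symm)
      rw [he.choose_spec]
      exact q.2

open Classical in
theorem onPoints_eq_some_iff {n m : ℕ} (f : Mor n m) (p : TotalPoint n) (q : TotalPoint m) :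
    onPoints f p = some q ↔ Mor.comp p.1 f = q.1 := by
  change (if h : (Mor.comp p.1 f).IsTotal then some (⟨Mor.comp p.1 f, h⟩ : TotalPoint m) else none)
    = some q ↔ _
  constructor
  · intro h
    split_ifs at h with hp
    exact congrArg Subtype.val (Option.some.inj h)
  · intro h
    have ht : (Mor.comp p.1 f).IsTotal := h ▸ q.2
    rw [dif_pos ht]
    exact congrArg some (Subtype.ext h)

/-- The functor `H₀` which evaluates the maps of `TOF` on total points. -/
noncomputable def H0 : TOF ⥤ Pinj where
  obj X := ⟨TotalPoint X.wires⟩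
  map f := onPoints f
  map_id X := by
    refine PEquiv.ext fun p => ?_
    refine ((onPoints_eq_some_iff _ p p).2 ?_)
    exact Mor.comp_id _
  map_comp {X Y Z} f g := by
    refine PEquiv.ext fun p => Option.ext fun r => ?_
    refine (onPoints_eq_some_iff _ p r).trans ?_
    refine Iff.trans ?_ (PEquiv.trans_eq_some (onPoints f) (onPoints g) p r).symm
    have ha : Mor.comp p.1 (f ≫ g) = Mor.comp (Mor.comp p.1 f) g := (Mor.assoc p.1 f g).symm
    constructor
    · intro h
      have ht : (Mor.comp (Mor.comp p.1 f) g).IsTotal := by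
        rw [← ha, h]; exact r.2
      refine ⟨⟨Mor.comp p.1 f, Mor.isTotal_of_comp _ _ ht⟩, ?_, ?_⟩
      · exact (onPoints_eq_some_iff f p _).2 rfl
      · exact (onPoints_eq_some_iff g _ r).2 (ha.symm.trans h)
    · rintro ⟨q, hq, hr⟩
      have hq' := (onPoints_eq_some_iff f p q).1 hq
      have hr' := (onPoints_eq_some_iff g q r).1 hr
      rw [ha, hq', hr']

/-- The identification of bit-strings `b` with the total points `|b₁, …, bₙ⟩`. -/
noncomputable def ketEquiv (n : ℕ) : (Fin n → ZMod 2) ≃ TotalPoint n :=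
  Equiv.ofBijective (fun b => ⟨Mor.ket n b, Mor.isTotal_ket n b⟩)
    ⟨fun _ _ h => Mor.ket_injective n (congrArg Subtype.val h), fun p => by
      obtain ⟨b, hb⟩ := (Mor.isTotal_point_iff p.1).1 p.2
      exact ⟨b, Subtype.ext hb.symm⟩⟩

/-- The identification of bit-strings with total points, as an isomorphism in `Pinj`. -/
noncomputable def ketIso (X : TOF) : bitStrings X.wires ≅ H0.obj X where
  hom := (ketEquiv X.wires).toPEquiv
  inv := (ketEquiv X.wires).symm.toPEquiv
  hom_inv_id := by
    refine (Equiv.toPEquiv_trans (ketEquiv X.wires) (ketEquiv X.wires).symm).symm.trans ?_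
    exact congrArg Equiv.toPEquiv (Equiv.self_trans_symm (ketEquiv X.wires))
  inv_hom_id := by
    refine (Equiv.toPEquiv_trans (ketEquiv X.wires).symm (ketEquiv X.wires)).symm.trans ?_
    exact congrArg Equiv.toPEquiv (Equiv.symm_trans_self (ketEquiv X.wires))

/-- The functor obtained from `H₀` by restricting its codomain to `FPinj2`, with the total points
of `n` identified with the bit-strings of length `n`. -/
noncomputable def H0tilde : TOF ⥤ FPinj2 where
  obj X := X.wires
  map {X Y} f := InducedCategory.homMk ((ketIso X).hom ≫ H0.map f ≫ (ketIso Y).inv)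
  map_id X := by
    apply InducedCategory.hom_ext
    rw [H0.map_id, Category.id_comp, Iso.hom_inv_id]; rfl
  map_comp f g := by
    apply InducedCategory.hom_ext
    simp

/-! ### Circuits in polynomial form -/

namespace Circ

/-- The `not` gate controlled by `n` wires, `cnot n : n + 1 → n + 1`: the control wires are the
first `n` wires and the target wire is the last one. -/
def cnotN : (n : ℕ) → Circ (n + 1) (n + 1)
  | 0 => not
  | 1 => cnot
  | 2 => tof
  | j + 3 =>
    cast (by omega) (by omega)
      ((id 2 ⊠ ketZero ⊠ id (j + 2)) ⨾ (tof ⊠ id (j + 2)) ⨾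
        cast (n' := 3 + (j + 2)) (m' := 3 + (j + 2)) (by omega) (by omega)
          (id 2 ⊠ cnotN (j + 2)) ⨾
        (tof ⊠ id (j + 2)) ⨾ (id 2 ⊠ braZero ⊠ id (j + 2)))

/-- Circuits which only permute wires. -/
inductive IsPermutation : {n m : ℕ} → Circ n m → Prop
  | id (n : ℕ) : IsPermutation (id n)
  | symm (n m : ℕ) : IsPermutation (symm n m)
  | comp {n m k : ℕ} {f : Circ n m} {g : Circ m k} :
      IsPermutation f → IsPermutation g → IsPermutation (f ⨾ g)
  | tensor {n m n' m' : ℕ} {f : Circ n m} {g : Circ n' m'} :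
      IsPermutation f → IsPermutation g → IsPermutation (f ⊠ g)

/-- Circuits in polynomial form on `n + 1` wires: composites of controlled `not` gates whose
controls are among the first `n` wires and whose target is the last wire. A gate with `j` controls
and `k` unused wires is written by permuting the first `n = k + j` wires so that the controls come
directly above the target, and permuting back afterwards. -/
inductive IsPolynomialForm : (n : ℕ) → Circ (n + 1) (n + 1) → Prop
  | id (n : ℕ) : IsPolynomialForm n (id (n + 1))
  | gate (k j : ℕ) (π : Circ (k + j) (k + j)) (hπ : IsPermutation π) :
      IsPolynomialForm (k + j) ((π ⊠ id 1) ⨾ (id k ⊠ cnotN j) ⨾ (dag π ⊠ id 1))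
  | comp {n : ℕ} {f g : Circ (n + 1) (n + 1)} :
      IsPolynomialForm n f → IsPolynomialForm n g → IsPolynomialForm n (f ⨾ g)

/-- Circuits `n → n + m` obtained by iteratively adjoining a last wire in state `|0⟩` and applying
to the first `n` wires and this new wire a circuit in polynomial form. -/
inductive IsPolynomialSimulation (n : ℕ) : (m : ℕ) → Circ n (n + m) → Prop
  | zero : IsPolynomialSimulation n 0 (id n)
  | succ {m : ℕ} {p : Circ n (n + m)} {q : Circ (n + 1) (n + 1)} :
      IsPolynomialSimulation n m p → IsPolynomialForm n q →
      IsPolynomialSimulation n (m + 1) ((id n ⊠ ketZero) ⨾ q ⨾ (p ⊠ id 1))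

end Circ

/-- A circuit from `n` to `m`, as a map of `TOF`. -/
def Circ.toHom {n m : ℕ} (c : Circ n m) : (⟨n⟩ : TOF) ⟶ ⟨m⟩ := Mor.mk c

/-- The partial isomorphism of sets of bit-strings given by a map of `TOF` under `H0tilde`. -/
noncomputable def onBits {n m : ℕ} (f : (⟨n⟩ : TOF) ⟶ ⟨m⟩) :
    (Fin n → ZMod 2) ≃. (Fin m → ZMod 2) :=
  (H0tilde.map f).hom

end Toffoli

namespace Toffoli

namespace Circ

/-! ### Evaluation and the horizontal flip -/

/-! The proof is reversible computation: compute, select, uncompute. A controlled `not` gate adds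
the product of its control bits, a monomial, to its target. Since every function from bit-strings to
the two-element field is a polynomial function, composites of such gates with a common target add an
arbitrary function of the controls to it (`exists_isPolynomialForm`). Adjoining targets in state 0,
one for each coordinate of `f`, then produces the pair (b, f b) (`exists_isPolynomialSimulation`).

For a partial isomorphism g, the same construction computes (b, g b, flag), the flag being 1 exactly
where g is defined. The ancilla ⟨1| on the flag wire discards every other input. It remains to erase
b, and this is where injectivity enters: b is itself a function of g b, so some circuit turns g b
into (g b, b), and its horizontal flip removes b again (`eval_dag`, `exists_eval_eq`).

All of this takes place in the evaluation on lists of bits rather than in `TOF`. The transfer is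
`onBits_toHom_eq_some_iff`: the evaluation respects the defining congruence, and each point of `TOF`
is a bit-string or the degenerate point, two cases that the evaluation tells apart. No completeness
of the identities for general circuits is needed. -/

theorem eval_comp {n m k : ℕ} {f : Circ n m} {g : Circ m k} {l a r : List (ZMod 2)}
    (hf : f.eval l = some a) (hg : g.eval a = some r) : (f ⨾ g).eval l = some r := by
  simp [eval, hf, hg]

theorem eval_tensor {n m n' m' : ℕ} {f : Circ n m} {g : Circ n' m'} {l l' r r' : List (ZMod 2)}
    (hl : l.length = n) (hf : f.eval l = some r) (hg : g.eval l' = some r') :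
    (f ⊠ g).eval (l ++ l') = some (r ++ r') := by
  subst hl
  simp [eval, hf, hg]

theorem eval_symm_append {n m : ℕ} {l l' : List (ZMod 2)} (hl : l.length = n) :
    (symm n m).eval (l ++ l') = some (l' ++ l) := by
  subst hl
  simp [eval]

/-- Flipping a circuit horizontally inverts its evaluation. -/
theorem eval_dag {n m : ℕ} (f : Circ n m) : ∀ l r : List (ZMod 2), l.length = n →
    f.eval l = some r → f.dag.eval r = some l := by
  induction f with
  | id n => intro l r _ h; simpa [eval, dag, eq_comm] using h
  | comp f g hf hg =>
    intro l r hl h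
    simp only [eval, Option.bind_eq_some_iff] at h
    obtain ⟨a, ha, hb⟩ := h
    exact eval_comp (hg a r (eval_length f _ _ hl ha) hb) (hf l a hl ha)
  | @tensor n _ _ _ f g hf hg =>
    intro l r hl h
    simp only [eval, Option.bind_eq_some_iff, Option.some.injEq] at h
    obtain ⟨a, ha, b, hb, rfl⟩ := h
    have := eval_tensor (eval_length f _ _ (by simp [hl]) ha) (hf _ _ (by simp [hl]) ha)
      (hg _ _ (by simp [hl]) hb)
    rwa [List.take_append_drop] at this
  | symm n m =>
    intro l r hl h
    simp only [eval, Option.some.injEq] at h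
    subst h
    exact (eval_symm_append (by simp [hl])).trans (by rw [List.take_append_drop])
  | ketOne =>
    intro l r hl h
    rw [List.length_eq_zero_iff] at hl
    simp only [eval, Option.some.injEq] at h
    subst hl h
    rfl
  | braOne =>
    intro l r hl h
    simp only [eval] at h
    split_ifs at h with h1
    rw [h1]; rfl
  | tof =>
    intro l r hl h
    simp only [eval] at h
    split at h
    · simp only [Option.some.injEq] at h
      subst h
      -- The gate is its own inverse, because a * b is added to the target twice in characteristic
      -- two.
      simp [dag, eval, ← add_assoc, CharTwo.add_self_eq_zero]
    · simp at h

theorem eval_ketZero (l : List (ZMod 2)) : ketZero.eval l = some [0] := by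
  change (some [(1 : ZMod 2)]).bind not.eval = some [0]
  decide

theorem eval_braZero : braZero.eval [0] = some [] := by decide

theorem eval_id (n : ℕ) (l : List (ZMod 2)) : (id n).eval l = some l := rfl

/-! ### Controlled gates -/

/-- The ancilla stores the product of the first two controls, the smaller gate uses it as a single
control, and a second Toffoli gate clears it. The recursion therefore multiplies all the controls
together. The cases with at most two controls are finite checks. -/
theorem eval_cnotN : ∀ (n : ℕ) (l : List (ZMod 2)) (t : ZMod 2), l.length = n →
    (cnotN n).eval (l ++ [t]) = some (l ++ [l.prod + t])
  | 0, [], t, _ => by revert t; decide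
  | 1, [a], t, _ => by revert a t; decide
  | 2, [a, b], t, _ => by revert a b t; decide
  | j + 3, a :: b :: l, t, hl => by
    have hl : l.length = j + 1 := by simpa using hl
    have htof : ∀ c : ZMod 2, tof.eval [a, b, c] = some [a, b, a * b + c] := fun _ => rfl
    rw [cnotN, eval_cast]
    -- This returns the ancilla to 0; otherwise ⟨0| would be undefined on it.
    have hcancel : a * b + a * b = 0 := CharTwo.add_self_eq_zero _
    have hket : (id 2 ⊠ ketZero).eval [a, b] = some [a, b, 0] :=
      eval_tensor (l := [a, b]) (l' := []) rfl (eval_id 2 _) (eval_ketZero _)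
    have hbra : (id 2 ⊠ braZero).eval [a, b, a * b + a * b] = some [a, b] := by
      rw [hcancel]
      exact eval_tensor (l := [a, b]) (l' := [0]) rfl (eval_id 2 _) eval_braZero
    -- After the first Toffoli gate the ancilla carries `a * b`, so the controls of the smaller gate
    -- are `a * b :: l`, of length `j + 2`. The cast in the circuit only regroups the wires, so that
    -- the ancilla passes from the first block to the second.
    have ih := eval_cnotN (j + 2) (a * b :: l) t (by simp [hl])
    have h := eval_comp (eval_comp (eval_comp (eval_comp
      (eval_tensor (l := [a, b]) rfl hket (eval_id (j + 2) (l ++ [t])))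
      (eval_tensor (l := [a, b, 0]) rfl (htof 0) (eval_id (j + 2) _)))
      ((congrFun (eval_cast (n' := 3 + (j + 2)) (m' := 3 + (j + 2)) (by omega : 2 + (j + 2 + 1) = _)
        (by omega : 2 + (j + 2 + 1) = _) _) _).trans (by simpa using eval_tensor (l := [a, b]) rfl (eval_id 2 _) ih)))
      (eval_tensor (l := [a, b, a * b]) (r' := l ++ [a * b * l.prod + t]) rfl (htof _)
        (eval_id (j + 2) _)))
      (eval_tensor (l := [a, b, a * b + a * b]) rfl hbra (eval_id (j + 2) _))
    simpa [mul_assoc] using h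

/-- Every set of wires can be brought to the end by a permutation. -/
theorem exists_isPermutation_prod : ∀ (n : ℕ) (p : Fin n → Bool), ∃ (k j : ℕ) (_ : k + j = n)
    (π : Circ n n), IsPermutation π ∧ ∀ b : Fin n → ZMod 2, ∃ u v : List (ZMod 2),
      π.eval (List.ofFn b) = some (u ++ v) ∧ u.length = k ∧ v.length = j ∧
        v.prod = ∏ i, if p i then b i else 1
  | 0, _ => ⟨0, 0, rfl, id 0, .id 0, fun b => ⟨[], [], by simp [eval], rfl, rfl, by simp⟩⟩
  | n + 1, p => by
    obtain ⟨k, j, rfl, π, hπ, h⟩ := exists_isPermutation_prod n fun i => p i.castSucc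
    by_cases hp : p (Fin.last (k + j))
    -- A selected last wire is already at the end and is left there. The permutation is chosen
    -- before `b`; only the lists `u` and `v` depend on it. Since only the product of `v` is
    -- recorded, the order of the selected wires need not be tracked.
    · refine ⟨k, j + 1, rfl, π ⊠ id 1, hπ.tensor (.id 1), fun b => ?_⟩
      obtain ⟨u, v, h, hu, hv, hprod⟩ := h fun i => b i.castSucc
      refine ⟨u, v ++ [b (Fin.last _)], ?_, hu, by simp [hv], ?_⟩
      · rw [List.ofFn_succ', List.concat_eq_append, ← List.append_assoc]
        exact eval_tensor (by simp) h rfl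
      · rw [Fin.prod_univ_castSucc]
        simp [hprod, hp]
    -- An unselected last wire is moved up past the `j` selected ones, so that it ends the block of
    -- the unselected wires.
    · refine ⟨k + 1, j, by omega, (π ⊠ id 1) ⨾ cast rfl (by omega : k + (1 + j) = k + j + 1) (id k ⊠ symm j 1),
        (hπ.tensor (.id 1)).comp ?_, fun b => ?_⟩
      -- The codomain is generalised to a variable `m`, so that the cast disappears by substitution.
      · have hc : ∀ {m : ℕ} (e : k + (1 + j) = m),
            IsPermutation (cast rfl e (id k ⊠ symm j 1)) := by
          rintro m rfl
          exact (IsPermutation.id k).tensor (.symm j 1)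
        exact hc _
      · obtain ⟨u, v, h, hu, hv, hprod⟩ := h fun i => b i.castSucc
        refine ⟨u ++ [b (Fin.last _)], v, ?_, by simp [hu], hv, ?_⟩
        · rw [List.ofFn_succ', List.concat_eq_append]
          refine eval_comp (eval_tensor (by simp) h (eval_id _ _)) ?_
          rw [eval_cast, List.append_assoc, List.append_assoc]
          exact eval_tensor hu rfl (eval_symm_append hv)
        · rw [Fin.prod_univ_castSucc]
          simp [hprod, hp]

/-! ### Circuits in polynomial form compute all functions -/

/-- This realises one monomial: the chosen controls are permuted to stand just above the target, the
gate is applied, and the permutation is undone. The gate leaves its controls unchanged, so the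
flipped permutation receives exactly the list that the permutation produced and `eval_dag` applies.
-/
theorem exists_isPolynomialForm_prod (n : ℕ) (p : Fin n → Bool) :
    ∃ q, IsPolynomialForm n q ∧ ∀ (b : Fin n → ZMod 2) (t : ZMod 2),
      q.eval (List.ofFn b ++ [t]) =
        some (List.ofFn b ++ [(∏ i, if p i then b i else 1) + t]) := by
  obtain ⟨k, j, rfl, π, hπ, h⟩ := exists_isPermutation_prod n p
  refine ⟨_, .gate k j π hπ, fun b t => ?_⟩
  obtain ⟨u, v, h, hu, hv, hprod⟩ := h b
  refine eval_comp (eval_comp (eval_tensor (by simp) h (eval_id 1 [t]))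
    ((congrArg _ (List.append_assoc u v [t])).trans
      (eval_tensor hu (eval_id k u) (eval_cnotN j v t hv)))) ?_
  rw [← List.append_assoc, hprod]
  exact eval_tensor (by simp [hu, hv]) (eval_dag π _ _ (by simp) h) rfl

/-- Every function on a finite power of a finite field is a polynomial function, so induction on a
polynomial suffices: monomials are single gates or the empty circuit, and sums are composites. The
target starts with an arbitrary value `t`, not 0, so that the second factor of a composite can act
on the result of the first. -/
theorem exists_isPolynomialForm (n : ℕ) (g : (Fin n → ZMod 2) → ZMod 2) :
    ∃ q, IsPolynomialForm n q ∧ ∀ (b : Fin n → ZMod 2) (t : ZMod 2),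
      q.eval (List.ofFn b ++ [t]) = some (List.ofFn b ++ [g b + t]) := by
  obtain ⟨P, hP⟩ : ∃ P : MvPolynomial (Fin n) (ZMod 2), ∀ b, MvPolynomial.eval b P = g b := by
    -- Evaluation maps the polynomials of degree at most q - 1 in each variable onto all functions,
    -- q being the order of the field. The degree bound is not used afterwards.
    have h : g ∈ (MvPolynomial.restrictDegree (Fin n) (ZMod 2) (Fintype.card (ZMod 2) - 1)).map
        (MvPolynomial.evalₗ (ZMod 2) (Fin n)) := by
      rw [MvPolynomial.map_restrict_dom_evalₗ]
      trivial
    obtain ⟨P, -, hP⟩ := h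
    exact ⟨P, fun b => congrFun hP b⟩
  -- Replacing `g` by the polynomial function itself makes the goal a property of `P` alone, ready
  -- for induction.
  obtain rfl : (fun b => MvPolynomial.eval b P) = g := funext hP
  clear hP
  induction P using MvPolynomial.induction_on' with
  | monomial d c =>
    have h2 : c = 0 ∨ c = 1 := by revert c; decide
    obtain rfl | rfl := h2
    · exact ⟨_, .id n, fun b t => by simp [eval]⟩
    -- The controls are the variables that occur in the monomial; their exponents do not matter,
    -- because a positive power of a bit is that bit.
    · obtain ⟨q, hq, h⟩ := exists_isPolynomialForm_prod n fun i => d i ≠ 0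
      refine ⟨q, hq, fun b t => ?_⟩
      have hpow : ∀ (x : ZMod 2) (e : ℕ), (if e ≠ 0 then x else 1) = x ^ e := by
        intro x e
        rcases e with _ | e
        · simp
        · have : x = 0 ∨ x = 1 := by revert x; decide
          obtain rfl | rfl := this <;> simp
      simp only [h]
      rw [MvPolynomial.eval_monomial, one_mul, Finsupp.prod_fintype _ _ (by simp)]
      simp [← hpow]
  | add P Q hP hQ =>
    obtain ⟨q, hq, h⟩ := hP
    obtain ⟨q', hq', h'⟩ := hQ
    refine ⟨_, hq.comp hq', fun b t => (eval_comp (h b t) (h' b _)).trans ?_⟩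
    simp only [map_add]
    -- The later circuit adds its value outermost, so the summands appear in the opposite order.
    rw [add_left_comm, add_assoc]

/-- Induction on the number of outputs. The new wire stays last while the earlier simulation inserts
its outputs between the inputs and it. Hence the polynomial circuit applied first computes the last
coordinate of `f`, and the induction hypothesis supplies the others. -/
theorem exists_isPolynomialSimulation (n : ℕ) : ∀ (m : ℕ) (f : (Fin n → ZMod 2) → Fin m → ZMod 2),
    ∃ c, IsPolynomialSimulation n m c ∧ ∀ b : Fin n → ZMod 2,
      c.eval (List.ofFn b) = some (List.ofFn b ++ List.ofFn (f b))
  | 0, _ => ⟨_, .zero, fun b => by simp [eval]⟩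
  | m + 1, f => by
    obtain ⟨p, hp, h⟩ := exists_isPolynomialSimulation n m fun b i => f b i.castSucc
    obtain ⟨q, hq, h'⟩ := exists_isPolynomialForm n fun b => f b (Fin.last m)
    refine ⟨_, hp.succ hq, fun b => ?_⟩
    have hket : (id n ⊠ ketZero).eval (List.ofFn b) = some (List.ofFn b ++ [0]) := by
      simpa using eval_tensor (l := List.ofFn b) (by simp) (eval_id n _) (eval_ketZero [])
    refine (eval_comp (eval_comp hket (h' b 0))
      (eval_tensor (by simp) (h b) (eval_id 1 _))).trans ?_
    rw [List.ofFn_succ' (f := f b), List.concat_eq_append, add_zero, List.append_assoc]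

end Circ

/-! ### Evaluation on bit-strings is evaluation on total points -/

/-- This reduces the functor to a computation with lists. An equation between points of `TOF` passes
to evaluations because the evaluation respects the congruence. Conversely, by `Mor.good` the
composite is a bit-string or degenerate: a bit-string must be the one found by evaluation, and the
degenerate point evaluates to `none`. -/
theorem onBits_toHom_eq_some_iff {n m : ℕ} (c : Circ n m) (b : Fin n → ZMod 2)
    (d : Fin m → ZMod 2) :
    onBits c.toHom b = some d ↔ c.eval (List.ofFn b) = some (List.ofFn d) := by
  have h1 : onBits c.toHom b = some d ↔ Mor.comp (Mor.ket n b) (Mor.mk c) = Mor.ket m d := by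
    refine Iff.trans ?_ (onPoints_eq_some_iff (Mor.mk c) (ketEquiv n b) (ketEquiv m d))
    change ((ketEquiv n).toPEquiv.trans
      ((onPoints (Mor.mk c)).trans (ketEquiv m).symm.toPEquiv)) b = some d ↔ _
    simp [PEquiv.trans_eq_some, Equiv.toPEquiv_apply, Equiv.symm_apply_eq]
  have h2 : ∀ e : Fin m → ZMod 2, Mor.comp (Mor.ket n b) (Mor.mk c) = Mor.ket m e →
      c.eval (List.ofFn b) = some (List.ofFn e) := by
    intro e h
    rw [← Mor.mk_ketCirc, ← Mor.mk_ketCirc, ← Mor.mk_comp] at h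
    simpa [Circ.eval, Mor.eval_ketCirc] using Mor.eval_mk_eq h [] rfl
  rw [h1]
  refine ⟨h2 d, fun h => ?_⟩
  rcases Mor.good (Mor.comp (Mor.ket n b) (Mor.mk c)) with ⟨e, he⟩ | ho
  · have := h2 e he
    rw [h, Option.some.injEq] at this
    rw [he, List.ofFn_injective this]
  · rw [← Mor.mk_ketCirc, ← Mor.mk_omegaCirc, ← Mor.mk_comp] at ho
    have := Mor.eval_mk_eq ho [] rfl
    simp [Circ.eval, Mor.eval_ketCirc, Mor.eval_omegaCirc, h] at this

/-! ### Fullness -/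

/-- Every partial isomorphism is computed by a circuit: compute the value and a bit recording
definedness, select the inputs where that bit is one, and uncompute the input. -/
theorem exists_eval_eq {n m : ℕ} (g : (Fin n → ZMod 2) ≃. (Fin m → ZMod 2)) :
    ∃ c : Circ n m, ∀ (b : Fin n → ZMod 2) (d : Fin m → ZMod 2),
      c.eval (List.ofFn b) = some (List.ofFn d) ↔ g b = some d := by
  -- Outside the domain of `g` the default value 0 is harmless, since the flag is then 0 and the
  -- input is discarded. The flag is put last so that ⟨1| can act on the bottom wire.
  obtain ⟨p, -, hp⟩ := Circ.exists_isPolynomialSimulation n (m + 1) fun b =>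
    Fin.snoc ((g b).getD 0) (if (g b).isSome then 1 else 0)
  -- Here too the default 0 never matters: the simulation is used only at values `e` of `g`, where
  -- the partial inverse is defined.
  obtain ⟨q, -, hq⟩ := Circ.exists_isPolynomialSimulation m n fun d => (g.symm d).getD 0
  -- The crossing turns (b, g b) into (g b, b), the form of an output of `q`, so that the flip of
  -- `q` leaves g b alone.
  refine ⟨p ⨾ (Circ.id (n + m) ⊠ Circ.braOne) ⨾ Circ.symm n m ⨾ q.dag, fun b d => ?_⟩
  have hsnoc : ∀ (x : Fin m → ZMod 2) (t : ZMod 2), List.ofFn (Fin.snoc x t : Fin (m + 1) → ZMod 2)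
      = List.ofFn x ++ [t] := by
    intro x t
    rw [List.ofFn_succ', List.concat_eq_append]
    simp
  have hp := hp b
  rw [hsnoc, ← List.append_assoc] at hp
  have htake : ∀ (x : Fin m → ZMod 2) (t : ZMod 2),
      (Circ.id (n + m) ⊠ Circ.braOne).eval ((List.ofFn b ++ List.ofFn x) ++ [t]) =
        if t = 1 then some (List.ofFn b ++ List.ofFn x) else none := by
    intro x t
    have hl : n + m = (List.ofFn b ++ List.ofFn x).length := by simp
    simp only [Circ.eval, hl, List.take_left, List.drop_left]
    split_ifs <;> simp_all
  -- Only the composition clause of `Circ.eval` is unfolded, which keeps the factors intact for `hp`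
  -- and `htake`.
  simp only [Circ.eval.eq_2, hp, Option.bind_some, htake]
  cases h : g b with
  | none => simp
  | some e =>
    -- Injectivity of `g`, in the form of its partial inverse, is used here: the input is recovered
    -- from the value.
    have he : g.symm e = some b := (g.mem_iff_mem).2 h
    have hqe := hq e
    rw [he, Option.getD_some] at hqe
    simp only [Option.isSome_some, if_true, Option.getD_some, Option.bind_some,
      Circ.eval_symm_append (List.length_ofFn)]
    rw [Circ.eval_dag q _ _ (by simp) hqe, Option.some.injEq, Option.some.injEq,
      List.ofFn_injective.eq_iff]

theorem H0tilde_full : H0tilde.Full where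
  map_surjective {X Y} g := by
    obtain ⟨c, hc⟩ := exists_eval_eq (n := X.wires) (m := Y.wires) g.hom
    refine ⟨c.toHom, CategoryTheory.InducedCategory.hom_ext (PEquiv.ext fun b => Option.ext fun d => ?_)⟩
    exact (onBits_toHom_eq_some_iff c b d).trans (hc b d)

end Toffoli

theorem mainTheorem5 :
    Toffoli.H0tilde.Full ∧
      ∀ (n m : ℕ) (f : (Fin n → ZMod 2) → (Fin m → ZMod 2)),
        ∃ c : Toffoli.Circ n (n + m), Toffoli.Circ.IsPolynomialSimulation n m c ∧
          ∀ b : Fin n → ZMod 2,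
            Toffoli.onBits c.toHom b = some (Fin.append b (f b)) := by
  refine ⟨Toffoli.H0tilde_full, fun n m f => ?_⟩
  obtain ⟨c, hc, h⟩ := Toffoli.Circ.exists_isPolynomialSimulation n m f
  refine ⟨c, hc, fun b => (Toffoli.onBits_toHom_eq_some_iff c b _).2 ?_⟩
  rw [h, List.ofFn_fin_append]
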